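/- Let $\Gamma$ be a finite simple graph with vertex set $S$. For each $s\in S$ let $\Omega_s$ be a set and let $X_s\le \mathrm{Sym}(\Omega_s)$ be a (finitely generated) $2$-ended group acting regularly (simply transitively) on $\Omega_s$. **Canonical envelopes.** For $m\ge 1$ let $\mathcal G_m$ be the Cayley graph of $\mathbf Z/m\mathbf Z\times\mathbf Z$ with respect to the generating set $(\mathbf Z/m\mathbf Z\times\{0\})\cup(\mathbf Z/m\mathbf Z\times\{1\})$. Let $N_s$ be the largest finite normal subgroup of $X_s$ and $n_s=|N_s|$. A *canonical envelope* of $X_s$ is a subgroup of $\mathrm{Sym}(\Omega_s)$ that contains $X_s$ and is of the form $\sigma^{-1}\mathrm{Aut}(\mathcal G_m)\sigma$ for some bijection $\sigma$ from $\Omega_s$ to the vertex set of $\mathcal G_m$, where either $m=n_s$, or $m=2n_s$ and $X_s/N_s$ is infinite dihedral. **The building.** Let $G_\Gamma(\mathbf X)$ be the graph product of the groups $X_s$ over $\Gamma$, i.e. the quotient of the free product of the $X_s$ by the normal closure of all commutators $[x,y]$ with $x\in X_s$, $y\in X_t$ and $\{s,t\}$ an edge of $\Gamma$. Let $\mathcal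 B$ be the right-angled building of type $\Gamma$ whose chambers are the elements of $G_\Gamma(\mathbf X)$ and whose $s$-panels are the left cosets of $X_s$, and let $\mathrm{Aut}(\mathcal B)$ be the group of its type-preserving automorphisms. Let $\rho_s\colon G_\Gamma(\mathbf X)\to X_s$ be the homomorphism which is the identity on $X_s$ and trivial on $X_t$ for $t\ne s$, fix points $\omega_s\in\Omega_s$, and let $\lambda$ be the legal colouring $\lambda_s(c)=\rho_s(c)\,\omega_s\in\Omega_s$. The restriction of $\lambda_s$ to each $s$-panel $\mathcal P$ is a bijection onto $\Omega_s$; the local action of $g\in\mathrm{Aut}(\mathcal B)$ at $\mathcal P$ is the permutation $\lambda_s|_{g\mathcal P}\circ g\circ(\lambda_s|_{\mathcal P})^{-1}$ of $\Omega_s$. For $\mathbf F=(F_s)_{s\in S}$ with $F_s\le\mathrm{Sym}(\Omega_s)$, let $\mathcal U(\mathbf F)\le\mathrm{Aut}(\mathcal B)$ be the group of all automorphisms whose local action at every $s$-panel belongs to $F_s$, for all $s\in S$. It carries the permutation topology, i.e. the topology of pointwise convergence on the discrete set of chambers. **Proposition.** For each $s\in S$ let $L_s$ be a canonical envelope of $X_s$,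 and set $\mathbf X=(X_s)_{s\in S}$ and $\mathbf L=(L_s)_{s\in S}$. Then: 1. $\mathcal U(\mathbf L)$ is a totally disconnected locally compact (Hausdorff) group. 2. The action of $G_\Gamma(\mathbf X)$ on $\mathcal B$ by left multiplication is faithful and identifies $G_\Gamma(\mathbf X)$ with $\mathcal U(\mathbf X)$; moreover $\mathcal U(\mathbf X)\le\mathcal U(\mathbf L)$, and $\mathcal U(\mathbf X)$ is a cocompact lattice in $\mathcal U(\mathbf L)$, i.e. it is discrete, the quotient $\mathcal U(\mathbf L)/\mathcal U(\mathbf X)$ is compact, and that quotient carries a non-zero finite $\mathcal U(\mathbf L)$-invariant Borel measure. 3. If $\Gamma$ is not a complete graph, then $\mathcal U(\mathbf L)$ is not discrete. -/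

import Mathlib

open Equiv (Perm)

universe u v

/-! ### Two-ended groups and regular permutation groups -/

/-- A finitely generated group is two-ended if its Cayley graph with respect to a finite
generating set has exactly two ends (the number of ends is independent of that set). -/
def IsTwoEnded (G : Type u) [Group G] : Prop :=
  ∃ T : Finset G, Subgroup.closure (T : Set G) = ⊤ ∧
    (SimpleGraph.mulCayley (T : Set G)).end.encard = 2

/-- The permutation group `X` acts regularly, i.e. simply transitively. -/
def ActsRegularly {Ω : Type u} (X : Subgroup (Perm Ω)) : Prop :=
  Nonempty Ω ∧ ∀ a b : Ω, ∃! x : Perm Ω, x ∈ X ∧ x a = b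

/-! ### Canonical envelopes -/

/-- `N` is the largest finite normal subgroup of `G`. -/
structure IsLargestFiniteNormal {G : Type u} [Group G] (N : Subgroup G) : Prop where
  normal : N.Normal
  finite : Finite N
  le_of_normal_of_finite : ∀ M : Subgroup G, M.Normal → Finite M → M ≤ N

/-- The Cayley graph of `ℤ/m × ℤ` with respect to the generating set
`(ℤ/m × {0}) ∪ (ℤ/m × {1})`. -/
def lineGraph (m : ℕ) : SimpleGraph (ZMod m × ℤ) :=
  SimpleGraph.addCayley (Set.univ ×ˢ {0} ∪ Set.univ ×ˢ {1})

/-- The group `σ⁻¹ Aut(𝒢) σ` of all permutations of `Ω` which become automorphisms of the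
graph `𝒢` when `Ω` is identified with the vertex set of `𝒢` by means of the bijection `σ`. -/
def conjAut {Ω : Type u} {V : Type v} (𝒢 : SimpleGraph V) (σ : Ω ≃ V) : Subgroup (Perm Ω) where
  carrier := {g | ∀ a b : Ω, 𝒢.Adj (σ (g a)) (σ (g b)) ↔ 𝒢.Adj (σ a) (σ b)}
  one_mem' := fun _ _ => Iff.rfl
  mul_mem' := fun {g h} hg hh a b => (hg (h a) (h b)).trans (hh a b)
  inv_mem' := fun {g} hg a b => by
    simpa using (hg (g⁻¹ a) (g⁻¹ b)).symm

/-- `L` is a canonical envelope of `X` of the first kind: with `n` the order of the largest finite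
normal subgroup of `X`, the group `L` contains `X` and has the form `σ⁻¹ Aut(𝒢ₙ) σ`. -/
def IsCanonicalEnvelope₁ {Ω : Type u} (X L : Subgroup (Perm Ω)) : Prop :=
  X ≤ L ∧ ∃ N : Subgroup X, IsLargestFiniteNormal N ∧
    ∃ σ : Ω ≃ ZMod (Nat.card N) × ℤ, L = conjAut (lineGraph (Nat.card N)) σ

/-- `L` is a canonical envelope of `X` of the second kind: with `N` the largest finite
normal subgroup of `X` and `n` its order, the quotient `X / N` is infinite dihedral,
and the group `L` contains `X` and has the form `σ⁻¹ Aut(𝒢₂ₙ) σ`. -/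
def IsCanonicalEnvelope₂ {Ω : Type u} (X L : Subgroup (Perm Ω)) : Prop :=
  X ≤ L ∧ ∃ (N : Subgroup X) (hN : IsLargestFiniteNormal N),
    (haveI := hN.normal; Nonempty ((X ⧸ N) ≃* DihedralGroup 0)) ∧
    ∃ σ : Ω ≃ ZMod (2 * Nat.card N) × ℤ, L = conjAut (lineGraph (2 * Nat.card N)) σ

/-- `L` is one of the canonical envelopes of `X`. -/
def IsCanonicalEnvelope {Ω : Type u} (X L : Subgroup (Perm Ω)) : Prop :=
  IsCanonicalEnvelope₁ X L ∨ IsCanonicalEnvelope₂ X L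

/-! ### Graph products of groups -/

section GraphProduct

variable {S : Type v} (Γ : SimpleGraph S) (G : S → Type u) [∀ s, Group (G s)]

/-- The normal subgroup of the free product generated by the commutators of `x` and `y`, where
`x ∈ G s`, `y ∈ G t` and `{s, t}` is an edge of `Γ`. -/
def graphProductRel : Subgroup (Monoid.CoprodI G) :=
  Subgroup.normalClosure {w | ∃ s t : S, Γ.Adj s t ∧ ∃ (x : G s) (y : G t),
    w = Monoid.CoprodI.of x⁻¹ * Monoid.CoprodI.of y⁻¹ *
      Monoid.CoprodI.of x * Monoid.CoprodI.of y}

instance graphProductRel_normal : (graphProductRel Γ G).Normal :=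
  Subgroup.normalClosure_normal

/-- The graph product of the groups `G s` over the graph `Γ`. -/
abbrev GraphProduct : Type (max u v) := Monoid.CoprodI G ⧸ graphProductRel Γ G

/-- The canonical homomorphism from a vertex group to the graph product. -/
def GraphProduct.of (s : S) : G s →* GraphProduct Γ G :=
  (QuotientGroup.mk' (graphProductRel Γ G)).comp Monoid.CoprodI.of

open Classical in
/-- The homomorphism `ρ_s` from the graph product to the vertex group `G s` which is the identity
on `G s` and trivial on `G t` for all `t ≠ s`. -/
noncomputable def GraphProduct.proj (s : S) : GraphProduct Γ G →* G s :=
  QuotientGroup.lift (graphProductRel Γ G)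
    (Monoid.CoprodI.lift fun t => (Pi.evalMonoidHom G s).comp (MonoidHom.mulSingle G t)) <| by
      refine Subgroup.normalClosure_le_normal ?_
      rintro _ ⟨a, b, hab, x, y, rfl⟩
      have h : Commute ((Pi.mulSingle a x : ∀ t, G t) s) ((Pi.mulSingle b y : ∀ t, G t) s) :=
        (Pi.mulSingle_commute hab.ne x y).map (Pi.evalMonoidHom G s)
      simp only [SetLike.mem_coe, MonoidHom.mem_ker, map_mul, map_inv, Monoid.CoprodI.lift_of,
        MonoidHom.comp_apply, Pi.evalMonoidHom_apply, MonoidHom.mulSingle_apply]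
      rw [mul_assoc, h.eq]
      group

end GraphProduct

/-! ### Universal groups with prescribed local action -/

section UniversalGroup

variable {S : Type v} {C : Type*} {Ω : S → Type u}

/-- The group of type-preserving automorphisms of a chamber system with set of chambers `C` and
`s`-adjacency relations `adj s`: the permutations of `C` preserving `s`-adjacency for all `s`.
(In the case of a building, these are exactly the permutations preserving the Weyl distance.) -/
def chamberAut (adj : S → Setoid C) : Subgroup (Perm C) where
  carrier := {g | ∀ (s : S) (c d : C), adj s (g c) (g d) ↔ adj s c d}
  one_mem' := fun _ _ _ => Iff.rfl
  mul_mem' := fun {g h} hg hh s c d => (hg s (h c) (h d)).trans (hh s c d)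
  inv_mem' := fun {g} hg s c d => by
    simpa using (hg s (g⁻¹ c) (g⁻¹ d)).symm

/-- `f` is the local action of `g` at the `s`-panel containing `c₀`, that is, `f ∘ col s = col s ∘ g`
on that panel. If `col` is a legal colouring, then `col s` restricts to a bijection from the panel
to `Ω s`, and `f` is the unique permutation `col s ∘ g ∘ (col s)⁻¹`. -/
def IsLocalAction (adj : S → Setoid C) (col : ∀ s, C → Ω s) (g : Perm C) (s : S) (c₀ : C)
    (f : Perm (Ω s)) : Prop :=
  ∀ c : C, adj s c₀ c → col s (g c) = f (col s c)

/-- The universal group: all type-preserving automorphisms whose local action at every `s`-panel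
belongs to `F s`, for all `s`. -/
def universalGroup (adj : S → Setoid C) (col : ∀ s, C → Ω s) (F : ∀ s, Subgroup (Perm (Ω s))) :
    Subgroup (Perm C) where
  carrier := {g | g ∈ chamberAut adj ∧ ∀ (s : S) (c₀ : C), ∃ f ∈ F s, IsLocalAction adj col g s c₀ f}
  one_mem' := ⟨one_mem _, fun s _ => ⟨1, one_mem _, fun _ _ => rfl⟩⟩
  mul_mem' := by
    rintro g h ⟨hg, hg'⟩ ⟨hh, hh'⟩
    refine ⟨mul_mem hg hh, fun s c₀ => ?_⟩
    obtain ⟨f₁, hf₁, h₁⟩ := hh' s c₀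
    obtain ⟨f₂, hf₂, h₂⟩ := hg' s (h c₀)
    refine ⟨f₂ * f₁, mul_mem hf₂ hf₁, fun c hc => ?_⟩
    rw [Equiv.Perm.mul_apply, Equiv.Perm.mul_apply, h₂ _ ((hh s c₀ c).2 hc), h₁ c hc]
  inv_mem' := by
    rintro g ⟨hg, hg'⟩
    refine ⟨inv_mem hg, fun s c₀ => ?_⟩
    obtain ⟨f, hf, h⟩ := hg' s (g⁻¹ c₀)
    refine ⟨f⁻¹, inv_mem hf, fun c hc => ?_⟩
    rw [Equiv.Perm.eq_inv_iff_eq, ← h _ ((inv_mem hg s c₀ c).2 hc)]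
    simp

end UniversalGroup

/-! ### The right-angled building of a graph product -/

section Building

variable {S : Type v} {Ω : S → Type u} (Γ : SimpleGraph S) (X : ∀ s, Subgroup (Perm (Ω s)))

/-- The chambers of the right-angled building of type `Γ` are the elements of the graph product of
the groups `X s`. The `s`-panels are the left cosets of `X s`. -/
def buildingAdj (s : S) : Setoid (GraphProduct Γ fun s => X s) :=
  QuotientGroup.leftRel (GraphProduct.of Γ (fun s => X s) s).range

/-- The legal colouring `c ↦ ρ_s(c)` of the building, where `X s` is identified with `Ω s` by means
of the orbit map of the point `ω s`. -/
noncomputable def buildingColour (ω : ∀ s, Ω s) (s : S) (c : GraphProduct Γ fun s => X s) : Ω s :=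
  (GraphProduct.proj Γ (fun s => X s) s c : Perm (Ω s)) (ω s)

/-- The universal group `𝒰(F)` over the building of the graph product of the groups `X s`, with
respect to the legal colouring above. -/
noncomputable def buildingUniversalGroup (ω : ∀ s, Ω s) (F : ∀ s, Subgroup (Perm (Ω s))) :
    Subgroup (Perm (GraphProduct Γ fun s => X s)) :=
  universalGroup (buildingAdj Γ X) (buildingColour Γ X ω) F

end Building

/-! ### Topology and lattices -/

/-- The permutation topology: the topology of pointwise convergence on the discrete set `C`.
Groups of permutations carry the subspace topology. -/
instance permTopology (C : Type u) : TopologicalSpace (Perm C) :=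
  TopologicalSpace.induced (fun g : Perm C => (g : C → C))
    (@Pi.topologicalSpace C (fun _ => C) fun _ => ⊥)

/-- `H` is a totally disconnected locally compact (Hausdorff) group. -/
def IsTDLCGroup (H : Type u) [Group H] [TopologicalSpace H] : Prop :=
  IsTopologicalGroup H ∧ T2Space H ∧ LocallyCompactSpace H ∧ TotallyDisconnectedSpace H

/-- `Λ` is a lattice in `H`: it is discrete, and `H ⧸ Λ` carries a non-zero finite `H`-invariant
Borel measure. -/
def IsLatticeIn {H : Type u} [Group H] [TopologicalSpace H] (Λ : Subgroup H) : Prop :=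
  DiscreteTopology Λ ∧
    ∃ μ : @MeasureTheory.Measure (H ⧸ Λ) (borel (H ⧸ Λ)),
      0 < μ Set.univ ∧ μ Set.univ < ⊤ ∧
      ∀ (h : H) (A : Set (H ⧸ Λ)), @MeasurableSet _ (borel (H ⧸ Λ)) A →
        μ ((fun x => h • x) ⁻¹' A) = μ A

/-- `Λ` is a cocompact lattice in `H`. -/
def IsCocompactLatticeIn {H : Type u} [Group H] [TopologicalSpace H] (Λ : Subgroup H) : Prop :=
  IsLatticeIn Λ ∧ CompactSpace (H ⧸ Λ)

/-! ### A criterion for cocompact lattices -/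

/-! Everything rests on the stabilizer `K` of the chamber `1` in `𝒰(L)`. It is open by definition of
the topology. Each `L s` is a conjugate of the automorphism group of a connected locally finite
graph, so its point stabilizers have finite orbits and membership in it can be tested on pairs of
points. Following galleries from `1`, the first property makes all `K`-orbits finite
(`finite_stabilizer_orbit`); the second makes `𝒰(L)` closed in the full permutation group
(`mem_buildingUniversalGroup_of_approx`). Hence `K` is compact, which gives local compactness.

Since each `X s` is regular, an element of `𝒰(X)` is determined by its value at `1`, and so `𝒰(X)`
is the graph product acting simply transitively on chambers. Thus `𝒰(X)` is a countable complement
of the compact open subgroup `K`. Such a complement is discrete and cocompact; moreover, it forces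
unimodularity, so Haar measure on `K` pushes forward to a finite invariant measure on the quotient.

For non-discreteness, take `s ≠ t` non-adjacent. The reflection of the line graph gives a
non-trivial element of `L s` fixing `ω s`, which extends to an automorphism permuting the wings of
the `s`-panel of `1` (`wingPerm`) and fixing every chamber that projects to `1` on that panel. All
but finitely many elements of the infinite group `X t` move a given chamber into this fixed set
(`finite_setOf_panelProj_of_mul_ne`), so suitable conjugates of the wing permutation are non-trivial
and arbitrarily close to `1`. The panel projection is built from the universal property, via an
action on pairs (`panelHom`), instead of normal forms. -/

open MeasureTheory MeasureTheory.Measure in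
/-- A locally compact group with a compact open subgroup `K` and a countable complement `Λ` of `K`
is unimodular. -/
theorem isMulRightInvariant_haar_of_isComplement {H : Type u} [Group H] [TopologicalSpace H]
    [IsTopologicalGroup H] [LocallyCompactSpace H] [MeasurableSpace H] [BorelSpace H]
    {K Λ : Subgroup H} (hKo : IsOpen (K : Set H)) (hKc : IsCompact (K : Set H)) [Countable Λ]
    (hc : ∀ g : H, ∃! l : Λ, (l : H) * g ∈ K) :
    (haar : Measure H).IsMulRightInvariant := by
  have hK : IsFundamentalDomain Λ (K : Set H) (haar : Measure H) :=
    IsFundamentalDomain.mk' hKo.measurableSet.nullMeasurableSet hc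
  refine ⟨fun g => ?_⟩
  have hcont : Continuous fun x : H => x * g := continuous_mul_const g
  have hKg : IsFundamentalDomain Λ ((fun x => x * g) ⁻¹' (K : Set H)) (haar : Measure H) := by
    refine IsFundamentalDomain.mk' (hKo.preimage hcont).measurableSet.nullMeasurableSet fun x => ?_
    simpa [Subgroup.smul_def, mul_assoc] using hc (x * g)
  have : Regular (map (fun x : H => x * g) haar) := Regular.map (Homeomorph.mulRight g)
  have hmap := isMulLeftInvariant_eq_smul_of_regular (map (fun x : H => x * g) haar)
    (haar : Measure H)
  -- Both `K` and its right translate are fundamental domains for left multiplication by `Λ`, so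
  -- they have equal Haar measure. This pins the scalar factor to `1`.
  have hval : (map (fun x : H => x * g) haar) (K : Set H) = (haar : Measure H) (K : Set H) := by
    rw [map_apply hcont.measurable hKo.measurableSet]
    exact hKg.measure_eq hK
  have hpos : (haar : Measure H) (K : Set H) ≠ 0 := (hKo.measure_pos _ ⟨1, K.one_mem⟩).ne'
  have hfin : (haar : Measure H) (K : Set H) ≠ ⊤ := hKc.measure_lt_top.ne
  set c := haarScalarFactor (map (fun x : H => x * g) haar) (haar : Measure H) with hcdef
  have hc1 : (c : ENNReal) = 1 := by
    have h2 : (c : ENNReal) * (haar : Measure H) (K : Set H) = (haar : Measure H) (K : Set H) := by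
      exact (congrArg (fun m : Measure H => m (K : Set H)) hmap).symm.trans hval
    rw [← ENNReal.mul_left_inj hpos hfin, h2, one_mul]
  rw [hmap, ENNReal.coe_eq_one.1 hc1, one_smul]

open MeasureTheory MeasureTheory.Measure in
/-- A countable subgroup complementing a compact open subgroup is a cocompact lattice. -/
theorem isCocompactLatticeIn_of_isComplement {H : Type u} [Group H] [TopologicalSpace H]
    [IsTopologicalGroup H] {K Λ : Subgroup H} (hKo : IsOpen (K : Set H))
    (hKc : IsCompact (K : Set H)) [Countable Λ] (hc : ∀ g : H, ∃! l : Λ, (l : H) * g ∈ K) :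
    IsCocompactLatticeIn Λ := by
  have : LocallyCompactSpace H :=
    hKc.locallyCompactSpace_of_mem_nhds_of_group (hKo.mem_nhds K.one_mem)
  -- Inversion turns the complement condition into one for right multiplication by `Λ`, the action
  -- whose orbits are the points of `H ⧸ Λ`.
  have hcop (g : H) : ∃! l : Λ.op, l • g ∈ (K : Set H) := by
    obtain ⟨l, hl, hu⟩ := hc g⁻¹
    refine ⟨⟨MulOpposite.op (l : H)⁻¹, by simp⟩, ?_, ?_⟩
    · simpa [Subgroup.smul_def] using K.inv_mem hl
    · rintro ⟨m, hm⟩ hmK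
      have := hu ⟨(MulOpposite.unop m)⁻¹, Λ.inv_mem hm⟩ (by
        simpa [Subgroup.smul_def] using K.inv_mem hmK)
      simp [← this]
  refine ⟨⟨?_, ?_⟩, ?_⟩
  · refine discreteTopology_of_isOpen_singleton_one ?_
    convert! hKo.preimage (continuous_subtype_val (p := fun x => x ∈ Λ)) using 1
    ext l
    simp only [Set.mem_singleton_iff, Set.mem_preimage, SetLike.mem_coe]
    refine ⟨fun h => by simp [h], fun h => ?_⟩
    exact (hc 1).unique (by simpa using h) (by simp)
  · let : MeasurableSpace H := borel H
    have : BorelSpace H := ⟨rfl⟩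
    let : MeasurableSpace (H ⧸ Λ) := borel (H ⧸ Λ)
    have : BorelSpace (H ⧸ Λ) := ⟨rfl⟩
    have := isMulRightInvariant_haar_of_isComplement hKo hKc hc
    have : Countable Λ.op := Λ.equivOp.symm.injective.countable
    have hmk : Measurable (QuotientGroup.mk : H → H ⧸ Λ) := QuotientGroup.continuous_mk.measurable
    have hmeas (A : Set (H ⧸ Λ)) (hA : MeasurableSet A) :
        map QuotientGroup.mk ((haar : Measure H).restrict K) A =
          haar (QuotientGroup.mk ⁻¹' A ∩ (K : Set H)) := by
      rw [map_apply hmk hA, restrict_apply (hmk hA)]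
    -- The invariant measure is the image of Haar measure restricted to `K`.
    refine ⟨map QuotientGroup.mk ((haar : Measure H).restrict K), ?_, ?_, fun h A hA => ?_⟩
    · rw [hmeas _ MeasurableSet.univ]
      simpa using hKo.measure_pos _ ⟨1, K.one_mem⟩
    · rw [hmeas _ MeasurableSet.univ]
      simpa using hKc.measure_lt_top
    · have hhA : MeasurableSet ((fun x : H ⧸ Λ => h • x) ⁻¹' A) :=
        ((continuous_const_smul h).measurable hA)
      rw [hmeas _ hA]
      refine (hmeas _ hhA).trans ?_
      have hK : IsFundamentalDomain Λ.op (K : Set H) (haar : Measure H) :=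
        IsFundamentalDomain.mk' hKo.measurableSet.nullMeasurableSet hcop
      have hhK : IsFundamentalDomain Λ.op ((fun x => h * x) ⁻¹' (K : Set H)) (haar : Measure H) := by
        refine IsFundamentalDomain.mk'
          (hKo.preimage (continuous_const_mul h)).measurableSet.nullMeasurableSet fun x => ?_
        simpa [Subgroup.smul_def, mul_assoc] using hcop (h * x)
      -- `K` may be replaced by `h⁻¹K`, another fundamental domain for `Λ.op`; this uses that Haar
      -- measure is right invariant. Left invariance then finishes.
      rw [hK.measure_set_eq hhK (hmk hhA)]
      · rw [← measure_preimage_mul haar h (QuotientGroup.mk ⁻¹' A ∩ (K : Set H))]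
        rfl
      · rintro ⟨g, hg⟩
        ext x
        have : (QuotientGroup.mk (x * MulOpposite.unop g) : H ⧸ Λ) = QuotientGroup.mk x :=
          QuotientGroup.mk_mul_of_mem x hg
        simp only [Set.mem_preimage, Subgroup.smul_def, MulOpposite.smul_eq_mul_unop, this]
  · have : (Set.univ : Set (H ⧸ Λ)) = QuotientGroup.mk '' (K : Set H) := by
      refine (Set.eq_univ_of_forall fun q => ?_).symm
      induction q using QuotientGroup.induction_on with
      | H g =>
        obtain ⟨l, hl, -⟩ := hcop g
        refine ⟨_, hl, QuotientGroup.mk_mul_of_mem g l.2⟩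
    exact ⟨this ▸ hKc.image QuotientGroup.continuous_mk⟩

/-! ### The permutation topology -/

section PermTopology

open Filter Topology

variable {C : Type u}

theorem perm_tendsto_iff {ι : Type v} {l : Filter ι} {f : ι → Perm C} {g : Perm C} :
    Tendsto f l (𝓝 g) ↔ ∀ c, ∀ᶠ i in l, f i c = g c := by
  let : TopologicalSpace C := ⊥
  have : DiscreteTopology C := ⟨rfl⟩
  have h : IsInducing (fun g : Perm C => (g : C → C)) := ⟨rfl⟩
  rw [h.tendsto_nhds_iff, tendsto_pi_nhds]
  simp [nhds_discrete, tendsto_pure]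

theorem perm_mem_nhds_iff {g : Perm C} {U : Set (Perm C)} :
    U ∈ 𝓝 g ↔ ∃ F : Finset C, ∀ h : Perm C, (∀ c ∈ F, h c = g c) → h ∈ U := by
  constructor
  · let : TopologicalSpace C := ⊥
    have : DiscreteTopology C := ⟨rfl⟩
    have h : IsInducing (fun g : Perm C => (g : C → C)) := ⟨rfl⟩
    rw [h.nhds_eq_comap, nhds_pi]
    simp only [nhds_discrete]
    rintro ⟨V, hV, hVU⟩
    obtain ⟨I, t, ht, hI⟩ := Filter.mem_pi'.1 hV
    refine ⟨I, fun h hh => hVU (hI fun c hc => ?_)⟩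
    show h c ∈ t c
    rw [hh c hc]
    exact mem_pure.1 (ht c)
  · rintro ⟨F, hF⟩
    have h1 : ∀ᶠ h : Perm C in 𝓝 g, ∀ c ∈ F, h c = g c :=
      (Finset.eventually_all F).2 fun c _ => perm_tendsto_iff.1 tendsto_id c
    exact h1.mono hF

instance perm_isTopologicalGroup : IsTopologicalGroup (Perm C) where
  continuous_mul := continuous_iff_continuousAt.2 fun ⟨a, b⟩ => perm_tendsto_iff.2 fun c => by
    have ha := perm_tendsto_iff.1 (continuous_fst.tendsto (a, b)) (b c)
    have hb := perm_tendsto_iff.1 (continuous_snd.tendsto (a, b)) c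
    filter_upwards [ha, hb] with p h1 h2
    simp [h2, h1]
  continuous_inv := continuous_iff_continuousAt.2 fun a => perm_tendsto_iff.2 fun c => by
    filter_upwards [perm_tendsto_iff.1 (tendsto_id (x := 𝓝 a)) (a⁻¹ c)] with p h1
    rw [Perm.inv_eq_iff_eq]
    simpa using h1.symm

theorem perm_isClopen_setOf_apply_eq (a b : C) : IsClopen {g : Perm C | g a = b} := by
  constructor
  · rw [← isOpen_compl_iff, isOpen_iff_mem_nhds]
    exact fun g hg => perm_mem_nhds_iff.2 ⟨{a}, fun h hh => by simp_all⟩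
  · rw [isOpen_iff_mem_nhds]
    exact fun g hg => perm_mem_nhds_iff.2 ⟨{a}, fun h hh => by simp_all⟩

instance perm_totallySeparatedSpace : TotallySeparatedSpace (Perm C) :=
  totallySeparatedSpace_iff_exists_isClopen.2 fun g h hgh => by
    obtain ⟨c, hc⟩ : ∃ c, g c ≠ h c := by
      by_contra! H
      exact hgh (Equiv.ext H)
    exact ⟨{k | k c = g c}, perm_isClopen_setOf_apply_eq _ _, rfl, fun H => hc H.symm⟩

theorem isOpen_stabilizer_perm (H : Subgroup (Perm C)) (c : C) :
    IsOpen (MulAction.stabilizer H c : Set H) :=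
  (perm_isClopen_setOf_apply_eq c c).isOpen.preimage continuous_subtype_val

/-- In a closed permutation group, a point stabilizer with finite orbits is compact. -/
theorem isCompact_stabilizer_perm {H : Subgroup (Perm C)}
    (hclosed : ∀ g : Perm C, (∀ F : Finset C, ∃ h ∈ H, ∀ c ∈ F, h c = g c) → g ∈ H) (c₀ : C)
    (hfin : ∀ c, {d | ∃ h ∈ H, h c₀ = c₀ ∧ h c = d}.Finite) :
    IsCompact (MulAction.stabilizer H c₀ : Set H) := by
  rw [isCompact_iff_ultrafilter_le_nhds]
  intro 𝒰 h𝒰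
  have hst : ∀ᶠ g : H in (𝒰 : Filter H), g ∈ MulAction.stabilizer H c₀ := le_principal_iff.1 h𝒰
  -- Finite orbits make the ultrafilter constant at every chamber. This is applied to `g` and to
  -- `g⁻¹`, because a pointwise limit of permutations need not be bijective unless the inverses
  -- converge too.
  have key (f : H → H) (hf : ∀ g ∈ MulAction.stabilizer H c₀, f g ∈ MulAction.stabilizer H c₀)
      (c : C) : ∃ d, ∀ᶠ g : H in (𝒰 : Filter H), (f g : Perm C) c = d := by
    have : ∀ᶠ g : H in (𝒰 : Filter H), ∃ d ∈ {d | ∃ h ∈ H, h c₀ = c₀ ∧ h c = d},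
        (f g : Perm C) c = d :=
      hst.mono fun g hg => ⟨_, ⟨_, (f g).2, hf g hg, rfl⟩, rfl⟩
    obtain ⟨d, -, hd⟩ := (Ultrafilter.eventually_exists_mem_iff (hfin c)).1 this
    exact ⟨d, hd⟩
  choose φ hφ using key id fun _ => id
  choose ψ hψ using key (fun g => g⁻¹) fun _ => inv_mem
  have hφψ (c : C) : φ (ψ c) = c := by
    obtain ⟨g, h1, h2⟩ := ((hφ (ψ c)).and (hψ c)).exists
    rw [← h1, ← h2]
    simp
  have hψφ (c : C) : ψ (φ c) = c := by
    obtain ⟨g, h1, h2⟩ := ((hψ (φ c)).and (hφ c)).exists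
    rw [← h1, ← h2]
    simp
  let p : Perm C := ⟨φ, ψ, hψφ, hφψ⟩
  have hp : p ∈ H := hclosed p fun F => by
    obtain ⟨g, hg⟩ := ((Finset.eventually_all F).2 fun c _ => hφ c).exists
    exact ⟨g, g.2, hg⟩
  refine ⟨⟨p, hp⟩, ?_, ?_⟩
  · obtain ⟨g, h1, h2⟩ := ((hφ c₀).and hst).exists
    exact h1.symm.trans h2
  · rw [nhds_subtype, ← tendsto_iff_comap]
    exact perm_tendsto_iff.2 hφ

/-- A closed permutation group with a point stabilizer with finite orbits is locally compact. -/
theorem isTDLCGroup_perm {H : Subgroup (Perm C)}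
    (hclosed : ∀ g : Perm C, (∀ F : Finset C, ∃ h ∈ H, ∀ c ∈ F, h c = g c) → g ∈ H) (c₀ : C)
    (hfin : ∀ c, {d | ∃ h ∈ H, h c₀ = c₀ ∧ h c = d}.Finite) : IsTDLCGroup H := by
  refine ⟨inferInstance, inferInstance, ?_, inferInstance⟩
  exact (isCompact_stabilizer_perm hclosed c₀ hfin).locallyCompactSpace_of_mem_nhds_of_group
    ((isOpen_stabilizer_perm H c₀).mem_nhds (one_mem _))

end PermTopology

/-! ### Graph products -/

namespace GraphProduct

variable {S : Type v} {Γ : SimpleGraph S} {G : S → Type u} [∀ s, Group (G s)]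

@[simp]
theorem proj_of_same (s : S) (x : G s) : proj Γ G s (of Γ G s x) = x := by
  classical
  change (Monoid.CoprodI.lift fun t => (Pi.evalMonoidHom G s).comp (MonoidHom.mulSingle G t))
    (Monoid.CoprodI.of x) = x
  simp [Monoid.CoprodI.lift_of]

@[simp]
theorem proj_of_ne {s t : S} (h : s ≠ t) (x : G t) : proj Γ G s (of Γ G t x) = 1 := by
  classical
  change (Monoid.CoprodI.lift fun t => (Pi.evalMonoidHom G s).comp (MonoidHom.mulSingle G t))
    (Monoid.CoprodI.of x) = 1
  simp [Monoid.CoprodI.lift_of, Pi.mulSingle_eq_of_ne h]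

theorem of_injective (s : S) : Function.Injective (of Γ G s) :=
  Function.LeftInverse.injective (proj_of_same s)

theorem commute_of {s t : S} (h : Γ.Adj s t) (x : G s) (y : G t) :
    Commute (of Γ G s x) (of Γ G t y) := by
  have : of Γ G s x⁻¹ * of Γ G t y⁻¹ * of Γ G s x * of Γ G t y = 1 :=
    (QuotientGroup.eq_one_iff _).2 (Subgroup.subset_normalClosure ⟨s, t, h, x, y, rfl⟩)
  rw [map_inv, map_inv, ← mul_inv_rev, mul_assoc, inv_mul_eq_one] at this
  exact this.symm

@[elab_as_elim]
theorem induction_on {p : GraphProduct Γ G → Prop} (c : GraphProduct Γ G) (one : p 1)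
    (mul_of : ∀ c s (x : G s), p c → p (c * of Γ G s x)) : p c := by
  induction c using QuotientGroup.induction_on with
  | H w =>
    suffices ∀ c, p c → p (c * (w : GraphProduct Γ G)) by simpa using this 1 one
    induction w using Monoid.CoprodI.induction_on with
    | one => simp
    | of s x => exact fun c hc => mul_of c s x hc
    | mul a b ha hb =>
      intro c hc
      rw [QuotientGroup.mk_mul, ← mul_assoc]
      exact hb _ (ha c hc)

/-- The universal property of the graph product. -/
def lift {M : Type*} [Group M] (f : ∀ s, G s →* M)
    (hf : ∀ s t, Γ.Adj s t → ∀ x y, Commute (f s x) (f t y)) : GraphProduct Γ G →* M :=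
  QuotientGroup.lift (graphProductRel Γ G) (Monoid.CoprodI.lift f) <| by
    refine Subgroup.normalClosure_le_normal ?_
    rintro _ ⟨a, b, hab, x, y, rfl⟩
    simp only [SetLike.mem_coe, MonoidHom.mem_ker, map_mul, map_inv, Monoid.CoprodI.lift_of]
    rw [mul_assoc, (hf a b hab x y).eq]
    group

@[simp]
theorem lift_of {M : Type*} [Group M] (f : ∀ s, G s →* M)
    (hf : ∀ s t, Γ.Adj s t → ∀ x y, Commute (f s x) (f t y)) (s : S) (x : G s) :
    lift f hf (of Γ G s x) = f s x :=
  Monoid.CoprodI.lift_of f x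

instance [Countable S] [∀ s, Countable (G s)] : Countable (GraphProduct Γ G) := by
  have : Function.Surjective fun l : List (Σ s, G s) =>
      (l.map fun x => of Γ G x.1 x.2).prod := by
    intro c
    induction c using induction_on with
    | one => exact ⟨[], rfl⟩
    | mul_of c s x hc =>
      obtain ⟨l, rfl⟩ := hc
      exact ⟨l ++ [⟨s, x⟩], by simp⟩
  exact this.countable

end GraphProduct

/-! ### Automorphisms of the building and their local actions -/

section Building

variable {S : Type v} {Ω : S → Type u} {Γ : SimpleGraph S} {X L : ∀ s, Subgroup (Perm (Ω s))}
  {ω : ∀ s, Ω s}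

local notation "𝔾" => GraphProduct Γ fun s => X s
local notation "ι" => GraphProduct.of Γ fun s => X s
local notation "ρ" => GraphProduct.proj Γ fun s => X s

theorem buildingAdj_iff {s : S} {c d : 𝔾} :
    buildingAdj Γ X s c d ↔ ∃ x : X s, d = c * ι s x := by
  change QuotientGroup.leftRel _ c d ↔ _
  rw [QuotientGroup.leftRel_apply]
  exact exists_congr fun x => eq_inv_mul_iff_mul_eq.trans eq_comm

theorem buildingColour_mul (s : S) (k c : 𝔾) :
    buildingColour Γ X ω s (k * c) = (ρ s k : Perm (Ω s)) (buildingColour Γ X ω s c) := by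
  simp [buildingColour]

theorem buildingColour_mul_of (s : S) (c : 𝔾) (x : X s) :
    buildingColour Γ X ω s (c * ι s x) = (ρ s c : Perm (Ω s)) ((x : Perm (Ω s)) (ω s)) := by
  simp [buildingColour]

theorem ActsRegularly.eq_of_apply_eq {Ω : Type u} {X : Subgroup (Perm Ω)} (h : ActsRegularly X)
    {x y : X} {a : Ω} (hxy : (x : Perm Ω) a = (y : Perm Ω) a) : x = y :=
  Subtype.ext ((h.2 a ((y : Perm Ω) a)).unique ⟨x.2, hxy⟩ ⟨y.2, rfl⟩)

/-- The identification of a regular permutation group with the underlying set. -/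
noncomputable def ActsRegularly.orbitEquiv {Ω : Type u} {X : Subgroup (Perm Ω)}
    (h : ActsRegularly X) (a : Ω) : X ≃ Ω :=
  Equiv.ofBijective (fun x => (x : Perm Ω) a) ⟨fun _ _ hxy => h.eq_of_apply_eq hxy, fun b => by
    obtain ⟨x, ⟨hx, hxa⟩, -⟩ := h.2 a b
    exact ⟨⟨x, hx⟩, hxa⟩⟩

/-- The colouring is legal: it restricts to a bijection on every panel. -/
theorem buildingColour_bijective {s : S} (h : ActsRegularly (X s)) (c₀ : 𝔾) :
    Function.Bijective fun c : {c // buildingAdj Γ X s c₀ c} => buildingColour Γ X ω s c := by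
  constructor
  · rintro ⟨c, hc⟩ ⟨d, hd⟩ hcd
    obtain ⟨x, rfl⟩ := buildingAdj_iff.1 hc
    obtain ⟨y, rfl⟩ := buildingAdj_iff.1 hd
    simp only [buildingColour_mul_of, EmbeddingLike.apply_eq_iff_eq] at hcd
    simp only [h.eq_of_apply_eq hcd]
  · intro b
    obtain ⟨x, hx⟩ := (h.orbitEquiv (ω s)).surjective ((ρ s c₀ : Perm (Ω s))⁻¹ b)
    refine ⟨⟨c₀ * ι s x, buildingAdj_iff.2 ⟨x, rfl⟩⟩, ?_⟩
    simp only [buildingColour_mul_of]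
    rw [← Equiv.Perm.eq_inv_iff_eq]
    exact hx

/-- Every automorphism of the building has a local action at every panel. -/
theorem exists_isLocalAction {s : S} (h : ActsRegularly (X s)) {g : Perm 𝔾}
    (hg : g ∈ chamberAut (buildingAdj Γ X)) (c₀ : 𝔾) :
    ∃ f, IsLocalAction (buildingAdj Γ X) (buildingColour Γ X ω) g s c₀ f := by
  let e (c : 𝔾) := Equiv.ofBijective _ (buildingColour_bijective (ω := ω) h c)
  let γ : {c // buildingAdj Γ X s c₀ c} ≃ {c // buildingAdj Γ X s (g c₀) c} :=
    g.subtypeEquiv fun c => (hg s c₀ c).symm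
  refine ⟨((e c₀).symm.trans γ).trans (e (g c₀)), fun c hc => ?_⟩
  have : (e c₀).symm (buildingColour Γ X ω s c) = ⟨c, hc⟩ := by
    rw [Equiv.symm_apply_eq]
    rfl
  simp only [Equiv.trans_apply, this]
  rfl

theorem mul_mem_chamberAut (k : 𝔾) :
    MulAction.toPermHom 𝔾 𝔾 k ∈ chamberAut (buildingAdj Γ X) := by
  intro s c d
  simp [buildingAdj_iff, mul_assoc]

theorem isLocalAction_mul (k : 𝔾) (s : S) (c₀ : 𝔾) :
    IsLocalAction (buildingAdj Γ X) (buildingColour Γ X ω) (MulAction.toPermHom 𝔾 𝔾 k) s c₀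
      (ρ s k) :=
  fun c _ => buildingColour_mul s k c

theorem buildingUniversalGroup_mono {F F' : ∀ s, Subgroup (Perm (Ω s))} (h : ∀ s, F s ≤ F' s) :
    buildingUniversalGroup Γ X ω F ≤ buildingUniversalGroup Γ X ω F' :=
  fun _ hg => ⟨hg.1, fun s c₀ => (hg.2 s c₀).imp fun _ hf => ⟨h s hf.1, hf.2⟩⟩

theorem mul_mem_buildingUniversalGroup (h : ∀ s, X s ≤ L s) (k : 𝔾) :
    MulAction.toPermHom 𝔾 𝔾 k ∈ buildingUniversalGroup Γ X ω L :=
  ⟨mul_mem_chamberAut k, fun s c₀ => ⟨_, h s (ρ s k).2, isLocalAction_mul k s c₀⟩⟩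

/-- The universal group with regular local actions is the graph product. -/
theorem range_toPermHom_eq_buildingUniversalGroup (hreg : ∀ s, ActsRegularly (X s)) :
    (MulAction.toPermHom 𝔾 𝔾).range = buildingUniversalGroup Γ X ω X := by
  refine le_antisymm ?_ fun g hg => ⟨g 1, Equiv.ext fun c => ?_⟩
  · rintro _ ⟨k, rfl⟩
    exact mul_mem_buildingUniversalGroup (fun _ => le_rfl) k
  · change g 1 * c = g c
    induction c using GraphProduct.induction_on with
    | one => exact mul_one _
    | mul_of c s x hc =>
      obtain ⟨f, hf, hloc⟩ := hg.2 s c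
      have hadj : buildingAdj Γ X s c (c * ι s x) := buildingAdj_iff.2 ⟨x, rfl⟩
      obtain ⟨y, hy⟩ := buildingAdj_iff.1 ((hg.1 s _ _).2 hadj)
      have h1 := hloc c ((buildingAdj Γ X s).refl c)
      have h2 := hloc _ hadj
      rw [hy, buildingColour_mul_of, buildingColour_mul_of] at h2
      -- Regularity turns agreement at the single point `ω s` into equality in `X s`; comparing the
      -- colours at the second chamber then forces `y = x`.
      have h3 : ρ s (g c) = ⟨f, hf⟩ * ρ s c := (hreg s).eq_of_apply_eq (a := ω s) h1
      rw [h3] at h2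
      simp only [Subgroup.coe_mul, Perm.mul_apply, EmbeddingLike.apply_eq_iff_eq] at h2
      rw [hy, ← hc, (hreg s).eq_of_apply_eq h2, mul_assoc]

/-- The universal group is closed if the local actions are prescribed by a condition on pairs of
points. -/
theorem mem_buildingUniversalGroup_of_approx (hreg : ∀ s, ActsRegularly (X s))
    (hL : ∀ s (f : Perm (Ω s)), (∀ a b, ∃ f' ∈ L s, f' a = f a ∧ f' b = f b) → f ∈ L s)
    (g : Perm 𝔾) (hg : ∀ F : Finset 𝔾, ∃ h ∈ buildingUniversalGroup Γ X ω L, ∀ c ∈ F, h c = g c) :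
    g ∈ buildingUniversalGroup Γ X ω L := by
  classical
  have hg1 : g ∈ chamberAut (buildingAdj Γ X) := by
    intro s c d
    obtain ⟨h, hh, hF⟩ := hg {c, d}
    rw [← hF c (by simp), ← hF d (by simp)]
    exact hh.1 s c d
  refine ⟨hg1, fun s c₀ => ?_⟩
  obtain ⟨f, hf⟩ := exists_isLocalAction (ω := ω) (hreg s) hg1 c₀
  refine ⟨f, hL s f fun a b => ?_, hf⟩
  obtain ⟨⟨c, hc⟩, rfl⟩ := (buildingColour_bijective (ω := ω) (hreg s) c₀).surjective a
  obtain ⟨⟨d, hd⟩, rfl⟩ := (buildingColour_bijective (ω := ω) (hreg s) c₀).surjective b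
  obtain ⟨h, hh, hF⟩ := hg {c, d}
  obtain ⟨f', hf', hloc⟩ := hh.2 s c₀
  refine ⟨f', hf', ?_, ?_⟩
  · rw [← hf c hc, ← hF c (by simp), hloc c hc]
  · rw [← hf d hd, ← hF d (by simp), hloc d hd]

/-- Once one `f₀ ∈ L` takes `a` to `a'`, all others differ from it by elements fixing `a`, so the
set lies in the `f₀`-image of a stabilizer orbit. -/
theorem finite_transporter_image {Ω : Type u} {L : Subgroup (Perm Ω)}
    (hL : ∀ a b, {c | ∃ f ∈ L, f a = a ∧ f b = c}.Finite) (a a' b : Ω) :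
    {c | ∃ f ∈ L, f a = a' ∧ f b = c}.Finite := by
  by_cases h : ∃ f₀ ∈ L, f₀ a = a'
  · obtain ⟨f₀, hf₀, rfl⟩ := h
    refine ((hL a b).image f₀).subset ?_
    rintro _ ⟨f, hf, hfa, rfl⟩
    exact ⟨(f₀⁻¹ * f) b, ⟨_, mul_mem (inv_mem hf₀) hf, by simp [hfa], rfl⟩, by simp⟩
  · refine Set.finite_empty.subset ?_
    rintro _ ⟨f, hf, hfa, rfl⟩
    exact h ⟨f, hf, hfa⟩

/-- Chamber stabilizers in the universal group have finite orbits if point stabilizers in the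
local groups do. -/
theorem finite_stabilizer_orbit (hreg : ∀ s, ActsRegularly (X s))
    (hL : ∀ s (a b : Ω s), {c | ∃ f ∈ L s, f a = a ∧ f b = c}.Finite) (c : 𝔾) :
    {d | ∃ h ∈ buildingUniversalGroup Γ X ω L, h 1 = 1 ∧ h c = d}.Finite := by
  induction c using GraphProduct.induction_on with
  | one =>
    refine (Set.finite_singleton (1 : 𝔾)).subset ?_
    rintro _ ⟨h, -, h1, rfl⟩
    exact h1
  | mul_of c s x hc =>
    have hadj : buildingAdj Γ X s c (c * ι s x) := buildingAdj_iff.2 ⟨x, rfl⟩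
    -- If `h c = d`, the image of the next chamber lies in the `s`-panel of `d` and its colour lies
    -- in `A d`. Legality of the colouring then leaves finitely many candidates.
    let A (d : 𝔾) : Set (Ω s) := {b | ∃ f ∈ L s,
      f (buildingColour Γ X ω s c) = buildingColour Γ X ω s d ∧
        f (buildingColour Γ X ω s (c * ι s x)) = b}
    have hA (d : 𝔾) : {e | buildingAdj Γ X s d e ∧ buildingColour Γ X ω s e ∈ A d}.Finite := by
      refine Set.Finite.of_finite_image (f := buildingColour Γ X ω s)
        ((finite_transporter_image (hL s) _ _ _).subset (s := A d) ?_) ?_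
      · rintro _ ⟨e, he, rfl⟩
        exact he.2
      · intro e he e' he' hee
        exact congrArg Subtype.val
          ((buildingColour_bijective (ω := ω) (hreg s) d).injective
            (a₁ := ⟨e, he.1⟩) (a₂ := ⟨e', he'.1⟩) hee)
    refine (hc.biUnion fun d _ => hA d).subset ?_
    rintro _ ⟨h, hh, h1, rfl⟩
    obtain ⟨f, hf, hloc⟩ := hh.2 s c
    refine Set.mem_biUnion ⟨h, hh, h1, rfl⟩ ⟨(hh.1 s _ _).2 hadj, f, hf, ?_, ?_⟩
    · rw [hloc c ((buildingAdj Γ X s).refl c)]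
    · rw [hloc _ hadj]

end Building

/-! ### The projection of a graph product to a panel -/

namespace GraphProduct

variable {S : Type v} {Γ : SimpleGraph S} {G : S → Type u} [∀ s, Group (G s)]

variable (Γ G) in
/-- The subgroup of the graph product generated by the vertex groups of the star of `s`. -/
def star (s : S) : Subgroup (GraphProduct Γ G) :=
  Subgroup.closure {c | ∃ t, (t = s ∨ Γ.Adj s t) ∧ ∃ x, of Γ G t x = c}

theorem of_mem_star {s t : S} (h : t = s ∨ Γ.Adj s t) (x : G t) : of Γ G t x ∈ star Γ G s :=
  Subgroup.subset_closure ⟨t, h, x, rfl⟩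

theorem mul_of_mem_star_iff {s t : S} (h : t = s ∨ Γ.Adj s t) (c : GraphProduct Γ G) (x : G t) :
    c * of Γ G t x ∈ star Γ G s ↔ c ∈ star Γ G s :=
  Subgroup.mul_mem_cancel_right _ (of_mem_star h x)

theorem of_mul_mem_star_iff {s t : S} (h : t = s ∨ Γ.Adj s t) (c : GraphProduct Γ G) (x : G t) :
    of Γ G t x * c ∈ star Γ G s ↔ c ∈ star Γ G s :=
  Subgroup.mul_mem_cancel_left _ (of_mem_star h x)

theorem proj_eq_one_of_mem_star {s t : S} (h : ¬ (t = s ∨ Γ.Adj s t)) {c : GraphProduct Γ G}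
    (hc : c ∈ star Γ G s) : proj Γ G t c = 1 := by
  have : star Γ G s ≤ (proj Γ G t).ker := by
    refine (Subgroup.closure_le _).2 ?_
    rintro _ ⟨t', ht', x, rfl⟩
    refine proj_of_ne ?_ x
    rintro rfl
    exact h ht'
  exact this hc

open Classical in
/-- The action of the vertex group `G t` on pairs `(c, q)`, where `q` records the projection of `c`
to the `s`-panel of the identity: the first component is multiplied by `x⁻¹` from the right, and
the second one changes accordingly as long as `c` belongs to the star of `s`. -/
noncomputable def panelAction (s t : S) : G t →* Perm (GraphProduct Γ G × G s) :=
  MonoidHom.toHomPerm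
    { toFun x := fun a : GraphProduct Γ G × G s => (a.1 * (of Γ G t x)⁻¹,
        if a.1 ∈ star Γ G s then a.2 * (proj Γ G s (of Γ G t x))⁻¹ else a.2)
      map_one' := by
        funext a
        change (_, _) = a
        simp
      map_mul' x y := by
        funext a
        change (_, _) = ((a.1 * (of Γ G t y)⁻¹) * (of Γ G t x)⁻¹, _)
        refine Prod.ext (by simp [mul_assoc]) ?_
        by_cases ht : t = s ∨ Γ.Adj s t
        · have h (c : GraphProduct Γ G) : c * (of Γ G t y)⁻¹ ∈ star Γ G s ↔ c ∈ star Γ G s := by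
            rw [← map_inv, mul_of_mem_star_iff ht]
          simp only [h]
          split_ifs <;> simp [mul_assoc]
        · have hs : s ≠ t := fun e => ht (Or.inl e.symm)
          simp [proj_of_ne hs] }

open Classical in
theorem panelAction_apply (s t : S) (x : G t) (c : GraphProduct Γ G) (q : G s) :
    panelAction s t x (c, q) = (c * (of Γ G t x)⁻¹,
      if c ∈ star Γ G s then q * (proj Γ G s (of Γ G t x))⁻¹ else q) :=
  rfl

/-- Only letters from `G s` change `q`. If one of the two letters is of type `s`, the other is
adjacent to `s` and hence does not affect membership in the star. -/
theorem commute_panelAction (s : S) {t t' : S} (h : Γ.Adj t t') (x : G t) (y : G t') :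
    Commute (panelAction (Γ := Γ) s t x) (panelAction s t' y) := by
  refine Equiv.ext fun ⟨c, q⟩ => ?_
  simp only [Perm.mul_apply, panelAction_apply]
  have hxy : c * (of Γ G t' y)⁻¹ * (of Γ G t x)⁻¹ = c * (of Γ G t x)⁻¹ * (of Γ G t' y)⁻¹ := by
    rw [mul_assoc, mul_assoc, ← mul_inv_rev, ← mul_inv_rev, (commute_of h x y).eq]
  refine Prod.ext hxy ?_
  have key (c : GraphProduct Γ G) {t : S} (ht : t = s ∨ Γ.Adj s t) (x : G t) :
      c * (of Γ G t x)⁻¹ ∈ star Γ G s ↔ c ∈ star Γ G s := by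
    rw [← map_inv, mul_of_mem_star_iff ht]
  classical
  by_cases ht : s = t
  · subst ht
    simpa [proj_of_ne h.ne] using if_congr (key c (Or.inr h) y) rfl rfl
  · by_cases ht' : s = t'
    · subst ht'
      simpa [proj_of_ne ht] using if_congr (key c (Or.inr h.symm) x).symm rfl rfl
    · simp [proj_of_ne ht, proj_of_ne ht']

variable (Γ G) in
/-- The graph product acts on pairs `(c, q)`, extending `panelAction`. -/
noncomputable def panelHom (s : S) : GraphProduct Γ G →* Perm (GraphProduct Γ G × G s) :=
  lift (panelAction s) fun _ _ h x y => commute_panelAction s h x y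

theorem panelHom_fst (s : S) (g c : GraphProduct Γ G) (q : G s) :
    (panelHom Γ G s g (c, q)).1 = c * g⁻¹ := by
  induction g using induction_on generalizing c q with
  | one => simp
  | mul_of g t x hg =>
    rw [map_mul, Perm.mul_apply, panelHom, lift_of, panelAction_apply, ← panelHom, hg]
    simp [mul_assoc]

/-- Left multiplication by `G s` preserves the star and commutes with the right multiplications that
define the action. This is the source of the equivariance of `panelProj`. -/
theorem panelHom_of_mul (s : S) (x : G s) (g c : GraphProduct Γ G) (q : G s) :
    (panelHom Γ G s g (of Γ G s x * c, x * q)).2 = x * (panelHom Γ G s g (c, q)).2 := by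
  induction g using induction_on generalizing c q with
  | one => simp
  | mul_of g t y hg =>
    rw [map_mul, Perm.mul_apply, Perm.mul_apply, panelHom, lift_of, panelAction_apply,
      panelAction_apply, ← panelHom, ← hg]
    congr 2
    refine Prod.ext (mul_assoc _ _ _) ?_
    have h : of Γ G s x * c ∈ star Γ G s ↔ c ∈ star Γ G s := of_mul_mem_star_iff (Or.inl rfl) c x
    by_cases hc : c ∈ star Γ G s
    · simp [h.2 hc, hc, mul_assoc]
    · simp [mt h.1 hc, hc]

/-- The projection of the graph product to the `s`-panel of the identity. -/
noncomputable def panelProj (s : S) (c : GraphProduct Γ G) : G s :=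
  (panelHom Γ G s c⁻¹ (1, 1)).2

@[simp]
theorem panelProj_one (s : S) : panelProj (Γ := Γ) (G := G) s 1 = 1 := by
  simp [panelProj]

open Classical in
theorem panelProj_mul_of (s t : S) (c : GraphProduct Γ G) (x : G t) :
    panelProj s (c * of Γ G t x) =
      if c ∈ star Γ G s then panelProj s c * proj Γ G s (of Γ G t x) else panelProj s c := by
  have h : panelHom Γ G s c⁻¹ (1, 1) = (c, panelProj s c) :=
    Prod.ext (by rw [panelHom_fst, one_mul, inv_inv]) rfl
  rw [panelProj, mul_inv_rev, map_mul, Perm.mul_apply, h, ← map_inv, panelHom, lift_of,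
    panelAction_apply]
  simp

theorem panelProj_mul_of_ne {s t : S} (h : s ≠ t) (c : GraphProduct Γ G) (x : G t) :
    panelProj s (c * of Γ G t x) = panelProj s c := by
  simp [panelProj_mul_of, proj_of_ne h]

theorem panelProj_mul_of_of_mem {s : S} {c : GraphProduct Γ G} (hc : c ∈ star Γ G s) (x : G s) :
    panelProj s (c * of Γ G s x) = panelProj s c * x := by
  simp [panelProj_mul_of, hc]

theorem panelProj_mul_of_of_notMem {s : S} {c : GraphProduct Γ G} (hc : c ∉ star Γ G s)
    {t : S} (x : G t) : panelProj s (c * of Γ G t x) = panelProj s c := by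
  simp [panelProj_mul_of, hc]

theorem panelProj_of_mul (s : S) (x : G s) (c : GraphProduct Γ G) :
    panelProj s (of Γ G s x * c) = x * panelProj s c := by
  have h : panelHom Γ G s (of Γ G s x)⁻¹ (1, 1) = (of Γ G s x * 1, x * 1) := by
    rw [← map_inv, panelHom, lift_of, panelAction_apply]
    simp [one_mem]
  rw [panelProj, mul_inv_rev, map_mul, Perm.mul_apply, h, panelHom_of_mul]
  rfl

/-- Elements of the star of `s` are products of an element of `G s` and an element commuting
with `G s`. -/
theorem exists_of_mem_star {s : S} {c : GraphProduct Γ G} (hc : c ∈ star Γ G s) :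
    ∃ z, c = of Γ G s (panelProj s c) * z ∧ (∀ x, Commute z (of Γ G s x)) ∧
      proj Γ G s z = 1 := by
  -- A letter of type `s` commutes past `z` into the first factor; a letter adjacent to `s` is
  -- absorbed into `z`.
  have step : ∀ c ∈ star Γ G s, ∀ t, (t = s ∨ Γ.Adj s t) → ∀ y : G t,
      (∃ z, c = of Γ G s (panelProj s c) * z ∧ (∀ x, Commute z (of Γ G s x)) ∧
        proj Γ G s z = 1) →
      ∃ z, c * of Γ G t y = of Γ G s (panelProj s (c * of Γ G t y)) * z ∧
        (∀ x, Commute z (of Γ G s x)) ∧ proj Γ G s z = 1 := by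
    rintro c hc t (rfl | ht) y ⟨z, h1, h2, h3⟩
    · refine ⟨z, ?_, h2, h3⟩
      rw [panelProj_mul_of_of_mem hc, map_mul, mul_assoc, ← (h2 y).eq, ← mul_assoc, ← h1]
    · refine ⟨z * of Γ G t y, ?_, fun x => (h2 x).mul_left (commute_of ht x y).symm, ?_⟩
      · rw [panelProj_mul_of_ne ht.ne, ← mul_assoc, ← h1]
      · rw [map_mul, h3, proj_of_ne ht.ne, one_mul]
  induction hc using Subgroup.closure_induction_right with
  | one => exact ⟨1, by simp, fun _ => Commute.one_left _, map_one _⟩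
  | mul_right c hc y hy ih =>
    obtain ⟨t, ht, y, rfl⟩ := hy
    exact step c hc t ht y ih
  | mul_inv_cancel c hc y hy ih =>
    obtain ⟨t, ht, y, rfl⟩ := hy
    rw [← map_inv]
    exact step c hc t ht _ ih

theorem proj_eq_panelProj {s : S} {c : GraphProduct Γ G} (hc : c ∈ star Γ G s) :
    proj Γ G s c = panelProj s c := by
  obtain ⟨z, h1, -, h3⟩ := exists_of_mem_star hc
  conv_lhs => rw [h1]
  rw [map_mul, h3, proj_of_same, mul_one]

/-- If `t` does not belong to the star of `s`, then most elements of `G t` move any given chamber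
into the set of chambers which are projected to the identity. -/
theorem finite_setOf_panelProj_of_mul_ne {s t : S} (hst : s ≠ t) (hΓ : ¬ Γ.Adj s t)
    (c : GraphProduct Γ G) : {x : G t | panelProj s (of Γ G t x * c) ≠ 1}.Finite := by
  induction c using induction_on with
  | one =>
    convert! Set.finite_empty
    ext x
    simpa using panelProj_mul_of_ne hst (1 : GraphProduct Γ G) x
  | mul_of c t' y hc =>
    -- Appending `y` changes the projection only if `of x * c` lies in the star of `s`. There `ρ_t`
    -- is trivial, which excludes all `x` except `(ρ_t c)⁻¹`.
    refine (hc.union (Set.finite_singleton (proj Γ G t c)⁻¹)).subset fun x hx => ?_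
    by_contra! h
    simp only [Set.mem_union, Set.mem_ofPred_eq, Set.mem_singleton_iff, not_or, not_not] at h
    refine hx ?_
    rw [← mul_assoc, panelProj_mul_of_of_notMem _ _, h.1]
    intro hmem
    have := proj_eq_one_of_mem_star (t := t) (by simp [hst.symm, hΓ]) hmem
    rw [map_mul, proj_of_same] at this
    exact h.2 (eq_inv_of_mul_eq_one_left this)

/-- The permutation of the graph product which permutes the wings of the `s`-panel of the
identity according to `a`. -/
noncomputable def wingPerm (s : S) (a : Perm (G s)) : Perm (GraphProduct Γ G) where
  toFun c := of Γ G s (a (panelProj s c) * (panelProj s c)⁻¹) * c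
  invFun c := of Γ G s (a⁻¹ (panelProj s c) * (panelProj s c)⁻¹) * c
  left_inv c := by
    beta_reduce
    rw [panelProj_of_mul, inv_mul_cancel_right, ← mul_assoc, ← map_mul]
    simp
  right_inv c := by
    beta_reduce
    rw [panelProj_of_mul, inv_mul_cancel_right, ← mul_assoc, ← map_mul]
    simp

theorem wingPerm_apply (s : S) (a : Perm (G s)) (c : GraphProduct Γ G) :
    wingPerm s a c = of Γ G s (a (panelProj s c) * (panelProj s c)⁻¹) * c :=
  rfl

theorem wingPerm_apply_of_panelProj_eq_one {s : S} {a : Perm (G s)} (ha : a 1 = 1)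
    {c : GraphProduct Γ G} (hc : panelProj s c = 1) : wingPerm s a c = c := by
  simp [wingPerm_apply, hc, ha]

theorem wingPerm_apply_of {s : S} (a : Perm (G s)) (x : G s) :
    wingPerm s a (of Γ G s x) = of Γ G s (a x) := by
  have : panelProj s (of Γ G s x) = x := by
    simpa using panelProj_of_mul s x (1 : GraphProduct Γ G)
  rw [wingPerm_apply, this, ← map_mul, inv_mul_cancel_right]

theorem proj_wingPerm {s : S} (a : Perm (G s)) {c : GraphProduct Γ G} (hc : c ∈ star Γ G s) :
    proj Γ G s (wingPerm s a c) = a (proj Γ G s c) := by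
  rw [wingPerm_apply, map_mul, proj_of_same, proj_eq_panelProj hc, inv_mul_cancel_right]

theorem wingPerm_mul_of_of_panelProj_eq {s t : S} (a : Perm (G s)) {c : GraphProduct Γ G}
    {x : G t} (h : panelProj s (c * of Γ G t x) = panelProj s c) :
    wingPerm s a (c * of Γ G t x) = of Γ G s (a (panelProj s c) * (panelProj s c)⁻¹) *
      (c * of Γ G t x) := by
  rw [wingPerm_apply, h]

/-- Chambers with equal projection are multiplied on the left by the same element, so adjacency
survives. Otherwise `t = s` and `c = q z` in the star, with `z` commuting with `G s`, and the wing
permutation just replaces `q` by `a q`. -/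
theorem exists_wingPerm_mul_of (s : S) (a : Perm (G s)) (c : GraphProduct Γ G) (t : S) (x : G t) :
    ∃ y, wingPerm s a (c * of Γ G t x) = wingPerm s a c * of Γ G t y := by
  by_cases h : t = s ∧ c ∈ star Γ G s
  · obtain ⟨rfl, hc⟩ := h
    obtain ⟨z, h1, h2, -⟩ := exists_of_mem_star hc
    refine ⟨(a (panelProj t c))⁻¹ * a (panelProj t c * x), ?_⟩
    rw [wingPerm_apply, wingPerm_apply, panelProj_mul_of_of_mem hc]
    set q := panelProj t c
    rw [h1]
    simp only [map_mul, map_inv, mul_inv_rev, mul_assoc, (h2 x).eq, inv_mul_cancel_left]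
    rw [← map_inv (of Γ G t), ← mul_assoc z, (h2 _).eq, mul_assoc, (h2 _).eq]
    simp
  · have hp : panelProj s (c * of Γ G t x) = panelProj s c := by
      by_cases ht : t = s
      · subst ht
        exact panelProj_mul_of_of_notMem (fun hc => h ⟨rfl, hc⟩) x
      · exact panelProj_mul_of_ne (Ne.symm ht) c x
    exact ⟨x, by rw [wingPerm_mul_of_of_panelProj_eq a hp, wingPerm_apply, mul_assoc]⟩

end GraphProduct

/-! ### Wing permutations in the universal group -/

section Wing

variable {S : Type v} {Ω : S → Type u} {Γ : SimpleGraph S} {X L : ∀ s, Subgroup (Perm (Ω s))}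
  {ω : ∀ s, Ω s}

local notation "𝔾" => GraphProduct Γ fun s => X s
local notation "ι" => GraphProduct.of Γ fun s => X s
local notation "ρ" => GraphProduct.proj Γ fun s => X s

local notation "π" => GraphProduct.panelProj (Γ := Γ) (G := fun s => X s)
local notation "φ" => GraphProduct.wingPerm (Γ := Γ) (G := fun s => X s)

open GraphProduct

/-- The local action is `α` on the `s`-panels in the star of `s`. On any other panel the map is left
multiplication by a fixed element, whose local action is in `X t ≤ L t`. -/
theorem wingPerm_mem_buildingUniversalGroup (h : ∀ s, X s ≤ L s) {s : S} {α : Perm (Ω s)}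
    (hα : α ∈ L s) {a : Perm (X s)}
    (ha : ∀ x, (a x : Perm (Ω s)) (ω s) = α ((x : Perm (Ω s)) (ω s))) :
    φ s a ∈ buildingUniversalGroup Γ X ω L := by
  have hadj (b : Perm (X s)) (t : S) (c d : 𝔾) (hcd : buildingAdj Γ X t c d) :
      buildingAdj Γ X t (φ s b c) (φ s b d) := by
    obtain ⟨x, rfl⟩ := buildingAdj_iff.1 hcd
    rw [buildingAdj_iff]
    exact exists_wingPerm_mul_of (Γ := Γ) (G := fun s => X s) s b c t x
  refine ⟨fun t c d => ⟨fun H => ?_, hadj a t c d⟩, fun t c₀ => ?_⟩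
  · have := hadj a⁻¹ t _ _ H
    have hinv (c : 𝔾) : φ s a⁻¹ (φ s a c) = c := (φ s a).symm_apply_apply c
    rwa [hinv, hinv] at this
  · by_cases hc : t = s ∧ c₀ ∈ star Γ (fun s => X s) s
    · obtain ⟨rfl, hc⟩ := hc
      refine ⟨α, hα, fun c hcc => ?_⟩
      obtain ⟨x, rfl⟩ := buildingAdj_iff.1 hcc
      have hmem : c₀ * ι t x ∈ star Γ (fun s => X s) t :=
        (mul_of_mem_star_iff (G := fun s => X s) (Or.inl rfl) c₀ x).2 hc
      rw [buildingColour, proj_wingPerm (G := fun s => X s) a hmem, ha]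
      rfl
    · refine ⟨_, h t (ρ t (ι s (a (π s c₀) * (π s c₀)⁻¹))).2, fun c hcc => ?_⟩
      obtain ⟨x, rfl⟩ := buildingAdj_iff.1 hcc
      have hp : π s (c₀ * ι t x) = π s c₀ := by
        by_cases ht : t = s
        · subst ht
          exact panelProj_mul_of_of_notMem (G := fun s => X s) (fun hc' => hc ⟨rfl, hc'⟩) x
        · exact panelProj_mul_of_ne (G := fun s => X s) (Ne.symm ht) c₀ x
      rw [wingPerm_mul_of_of_panelProj_eq (Γ := Γ) (G := fun s => X s) a hp, buildingColour_mul]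

/-- The universal group is non-discrete if some local group does not act freely and belongs to a
vertex which is not adjacent to some other vertex with infinite panels. -/
theorem not_discreteTopology_buildingUniversalGroup (h : ∀ s, X s ≤ L s) {s t : S} (hst : s ≠ t)
    (hΓ : ¬ Γ.Adj s t) (hs : ActsRegularly (X s)) [Infinite (X t)] {α : Perm (Ω s)}
    (hα : α ∈ L s) (hαω : α (ω s) = ω s) (hα1 : α ≠ 1) :
    ¬ DiscreteTopology (buildingUniversalGroup Γ X ω L) := by
  intro hd
  have h1 : {(1 : buildingUniversalGroup Γ X ω L)} ∈ nhds 1 :=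
    (isOpen_discrete _).mem_nhds rfl
  rw [nhds_subtype, Filter.mem_comap] at h1
  obtain ⟨V, hV, hV1⟩ := h1
  obtain ⟨F, hF⟩ := perm_mem_nhds_iff.1 hV
  obtain ⟨x, hx⟩ : ∃ x : X t, ∀ c ∈ F, π s (ι t x * c) = 1 := by
    obtain ⟨x, hx⟩ := (F.finite_toSet.biUnion fun c _ =>
      finite_setOf_panelProj_of_mul_ne hst hΓ c).infinite_compl.nonempty
    refine ⟨x, fun c hc => ?_⟩
    by_contra hne
    exact hx (Set.mem_biUnion hc hne)
  set a := (hs.orbitEquiv (ω s)).symm.permCongr α with ha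
  have ha1 : a 1 = 1 := by
    rw [ha, Equiv.permCongr_apply, Equiv.symm_apply_eq]
    exact hαω
  let k : Perm 𝔾 := MulAction.toPermHom 𝔾 𝔾 (ι t x)
  -- Translation by `x` moves `F` into the set fixed by the wing permutation, so this conjugate
  -- fixes `F` pointwise.
  let g : Perm 𝔾 := k⁻¹ * φ s a * k
  have hk : k ∈ buildingUniversalGroup Γ X ω L := mul_mem_buildingUniversalGroup h _
  have hg : g ∈ buildingUniversalGroup Γ X ω L :=
    mul_mem (mul_mem (inv_mem hk) (wingPerm_mem_buildingUniversalGroup h hα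
      fun x => (hs.orbitEquiv (ω s)).apply_symm_apply _)) hk
  have hgF : g ∈ V := hF g fun c hc => by
    change k⁻¹ (φ s a (ι t x * c)) = c
    rw [wingPerm_apply_of_panelProj_eq_one ha1 (hx c hc), Perm.inv_eq_iff_eq]
    rfl
  have hg1 : g = 1 := congrArg Subtype.val (hV1 (a := ⟨g, hg⟩) hgF)
  have hw : φ s a = 1 := by
    have : k⁻¹ * φ s a * k = k⁻¹ * k := hg1.trans (inv_mul_cancel k).symm
    rw [mul_assoc, mul_right_inj] at this
    exact mul_eq_right.1 this
  refine hα1 (Equiv.ext fun b => ?_)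
  obtain ⟨y, rfl⟩ := (hs.orbitEquiv (ω s)).surjective b
  have hy : a y = y := by
    have hy' : ι s (a y) = ι s y := by
      rw [← wingPerm_apply_of (Γ := Γ) (G := fun s => X s), hw]
      rfl
    exact of_injective s hy'
  rw [ha, Equiv.permCongr_apply, Equiv.symm_apply_eq] at hy
  exact hy

end Wing

/-! ### The automorphism groups of the line graphs -/

section LineGraph

variable {m : ℕ} {Ω : Type u}

theorem lineGraph_adj_iff {a b : ZMod m × ℤ} :
    (lineGraph m).Adj a b ↔ a ≠ b ∧ |a.2 - b.2| ≤ 1 := by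
  rw [lineGraph, SimpleGraph.addCayley_adj]
  refine and_congr_right fun _ => ?_
  simp only [Set.mem_union, Set.mem_prod, Set.mem_univ, Set.mem_singleton_iff, true_and,
    Prod.snd_add, Prod.snd_neg, abs_le]
  omega

theorem lineGraph_preconnected : (lineGraph m).Preconnected := by
  have step (i j : ZMod m) (k : ℤ) : (lineGraph m).Adj (i, k) (j, k + 1) := by
    simp [lineGraph_adj_iff]
  have key (k : ℤ) : ∀ i, (lineGraph m).Reachable (0, 0) (i, k) := by
    induction k using Int.induction_on with
    -- The detour through level `1` avoids treating `i = 0` separately.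
    | zero => exact fun i => (step 0 0 0).reachable.trans (step i 0 0).symm.reachable
    | succ k ih => exact fun i => (ih 0).trans (step 0 i k).reachable
    | pred k ih =>
      intro i
      have := step i 0 (-k - 1)
      rw [sub_add_cancel] at this
      exact (ih 0).trans this.symm.reachable
  exact fun a b => (key a.2 a.1).symm.trans (key b.2 b.1)

theorem finite_neighborSet_lineGraph [NeZero m] (a : ZMod m × ℤ) :
    ((lineGraph m).neighborSet a).Finite := by
  refine (Set.finite_univ.prod (Set.finite_Icc (a.2 - 1) (a.2 + 1))).subset fun b hb => ?_
  have := abs_le.1 (lineGraph_adj_iff.1 hb).2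
  exact ⟨trivial, by constructor <;> linarith⟩

/-- Point stabilizers in the automorphism group of a connected locally finite graph have finite
orbits. -/
theorem finite_stabilizer_orbit_conjAut {V : Type v} {𝒢 : SimpleGraph V} (hc : 𝒢.Preconnected)
    (hf : ∀ v, (𝒢.neighborSet v).Finite) (σ : Ω ≃ V) (a b : Ω) :
    {c | ∃ f ∈ conjAut 𝒢 σ, f a = a ∧ f b = c}.Finite := by
  suffices ∀ v, 𝒢.Reachable (σ a) v →
      {c | ∃ f ∈ conjAut 𝒢 σ, f a = a ∧ f (σ.symm v) = c}.Finite by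
    simpa using this (σ b) (hc _ _)
  intro v hv
  rw [SimpleGraph.reachable_iff_reflTransGen] at hv
  induction hv with
  | refl =>
    refine (Set.finite_singleton a).subset ?_
    rintro _ ⟨f, -, h1, rfl⟩
    simpa using h1
  | @tail v w _ hvw ih =>
    refine (ih.biUnion fun c _ => (hf (σ c)).preimage (f := σ) σ.injective.injOn).subset ?_
    rintro _ ⟨f, hfm, h1, rfl⟩
    refine Set.mem_biUnion ⟨f, hfm, h1, rfl⟩ ?_
    exact (hfm _ _).2 (by simpa using hvw)

/-- Preserving a graph is a condition on pairs of vertices; this is what makes the universal group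
closed. -/
theorem mem_conjAut_of_pairs {V : Type v} {𝒢 : SimpleGraph V} {σ : Ω ≃ V} {f : Perm Ω}
    (h : ∀ a b, ∃ f' ∈ conjAut 𝒢 σ, f' a = f a ∧ f' b = f b) : f ∈ conjAut 𝒢 σ := by
  intro a b
  obtain ⟨f', hf', ha, hb⟩ := h a b
  rw [← ha, ← hb]
  exact hf' a b

/-- The reflection of the line graph at a given point. -/
theorem exists_mem_conjAut_lineGraph_fixing (σ : Ω ≃ ZMod m × ℤ) (a : Ω) :
    ∃ f ∈ conjAut (lineGraph m) σ, f a = a ∧ f ≠ 1 := by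
  let r : Perm (ZMod m × ℤ) := (Equiv.refl _).prodCongr (Equiv.subLeft (2 * (σ a).2))
  have hr (v : ZMod m × ℤ) : r v = (v.1, 2 * (σ a).2 - v.2) := rfl
  refine ⟨σ.symm.permCongr r, fun b c => ?_, ?_, fun h => ?_⟩
  · simp only [Equiv.permCongr_apply, Equiv.apply_symm_apply, Equiv.symm_symm, lineGraph_adj_iff,
      ne_eq, EmbeddingLike.apply_eq_iff_eq]
    rw [hr, hr, sub_sub_sub_cancel_left, abs_sub_comm]
  · rw [Equiv.permCongr_apply, Equiv.symm_apply_eq, Equiv.symm_symm, hr]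
    ext
    · rfl
    · simp only
      ring
  -- The point one level above `a` is sent one level below it.
  · have := congrArg σ (DFunLike.congr_fun h (σ.symm ((σ a).1, (σ a).2 + 1)))
    simp only [Equiv.permCongr_apply, Equiv.apply_symm_apply, Equiv.symm_symm, hr,
      Perm.one_apply, Prod.mk.injEq, true_and] at this
    omega

/-- A canonical envelope contains the given group, and it is the automorphism group of one of the
line graphs. -/
theorem IsCanonicalEnvelope.exists_conjAut {X L : Subgroup (Perm Ω)}
    (h : IsCanonicalEnvelope X L) :
    X ≤ L ∧ ∃ m : ℕ, m ≠ 0 ∧ ∃ σ : Ω ≃ ZMod m × ℤ, L = conjAut (lineGraph m) σ := by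
  obtain ⟨hXL, N, hN, σ, hσ⟩ | ⟨hXL, N, hN, -, σ, hσ⟩ := h
  · have := hN.finite
    exact ⟨hXL, _, Nat.card_pos.ne', σ, hσ⟩
  · have := hN.finite
    exact ⟨hXL, _, (mul_pos two_pos Nat.card_pos).ne', σ, hσ⟩

end LineGraph

/-- Chamber stabilizers in the universal group complement the graph product. -/
theorem existsUnique_mul_mem_stabilizer {S : Type v} {Γ : SimpleGraph S} {Ω : S → Type u}
    {X L : ∀ s, Subgroup (Perm (Ω s))} {ω : ∀ s, Ω s} (hreg : ∀ s, ActsRegularly (X s))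
    (h : ∀ s, X s ≤ L s) (g : buildingUniversalGroup Γ X ω L) :
    ∃! l : (buildingUniversalGroup Γ X ω X).subgroupOf (buildingUniversalGroup Γ X ω L),
      (l : buildingUniversalGroup Γ X ω L) * g ∈
        MulAction.stabilizer (buildingUniversalGroup Γ X ω L)
          (1 : GraphProduct Γ fun s => X s) := by
  have hX (k : GraphProduct Γ fun s => X s) : MulAction.toPermHom _ _ k ∈
      buildingUniversalGroup Γ X ω X := mul_mem_buildingUniversalGroup (fun _ => le_rfl) k
  -- The only candidate is left multiplication by `(g 1)⁻¹`, since the graph product is simply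
  -- transitive on chambers.
  refine ⟨⟨⟨MulAction.toPermHom _ _ ((g : Perm (GraphProduct Γ fun s => X s)) 1)⁻¹, buildingUniversalGroup_mono h (hX _)⟩,
    hX _⟩, inv_mul_cancel ((g : Perm (GraphProduct Γ fun s => X s)) 1), ?_⟩
  rintro ⟨⟨l, hl⟩, hlX⟩ hl1
  have hlX' : l ∈ buildingUniversalGroup Γ X ω X := hlX
  rw [← range_toPermHom_eq_buildingUniversalGroup hreg] at hlX'
  obtain ⟨k, rfl⟩ := hlX'
  have hk : k * (g : Perm (GraphProduct Γ fun s => X s)) 1 = 1 := hl1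
  simp only [eq_inv_of_mul_eq_one_left hk]

theorem proposition5p6 {S : Type v} [Finite S] (Γ : SimpleGraph S) {Ω : S → Type u}
    (X L : ∀ s, Subgroup (Perm (Ω s)))
    (hX : ∀ s, IsTwoEnded (X s)) (hreg : ∀ s, ActsRegularly (X s))
    (hL : ∀ s, IsCanonicalEnvelope (X s) (L s)) (ω : ∀ s, Ω s) :
    -- `𝒰(L)` is a tdlc group
    IsTDLCGroup (buildingUniversalGroup Γ X ω L) ∧
    -- the graph product, acting on the building by left multiplication, is `𝒰(X)`
    Function.Injective (MulAction.toPermHom (GraphProduct Γ fun s => X s)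
      (GraphProduct Γ fun s => X s)) ∧
    (MulAction.toPermHom (GraphProduct Γ fun s => X s) (GraphProduct Γ fun s => X s)).range =
      buildingUniversalGroup Γ X ω X ∧
    -- `𝒰(X)` is contained in `𝒰(L)`, as a cocompact lattice
    buildingUniversalGroup Γ X ω X ≤ buildingUniversalGroup Γ X ω L ∧
    IsCocompactLatticeIn
      ((buildingUniversalGroup Γ X ω X).subgroupOf (buildingUniversalGroup Γ X ω L)) ∧
    -- `𝒰(L)` is non-discrete unless `Γ` is complete
    (Γ ≠ ⊤ → ¬ DiscreteTopology (buildingUniversalGroup Γ X ω L)) := by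
  choose hXL m hm σ hσ using fun s => (hL s).exists_conjAut
  -- Nonzero `m s` makes `ZMod (m s)` finite, hence the line graph locally finite.
  have (s : S) : NeZero (m s) := ⟨hm s⟩
  have hfin (s : S) (a b : Ω s) : {c | ∃ f ∈ L s, f a = a ∧ f b = c}.Finite := by
    rw [hσ s]
    exact finite_stabilizer_orbit_conjAut lineGraph_preconnected finite_neighborSet_lineGraph _ a b
  have hclosed := mem_buildingUniversalGroup_of_approx (Γ := Γ) (ω := ω) hreg (L := L)
    fun s f hf => by
      rw [hσ s] at hf ⊢
      exact mem_conjAut_of_pairs hf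
  have horb := finite_stabilizer_orbit (Γ := Γ) (ω := ω) hreg hfin
  have hrange := range_toPermHom_eq_buildingUniversalGroup (Γ := Γ) (ω := ω) hreg
  have (s : S) : Countable (X s) := (((hreg s).orbitEquiv (ω s)).trans (σ s)).injective.countable
  have : Countable (buildingUniversalGroup Γ X ω X) := by
    rw [← hrange]
    exact (MonoidHom.rangeRestrict_surjective _).countable
  have : Countable ((buildingUniversalGroup Γ X ω X).subgroupOf
      (buildingUniversalGroup Γ X ω L)) :=
    (Subgroup.subgroupOfEquivOfLe (buildingUniversalGroup_mono hXL)).injective.countable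
  refine ⟨isTDLCGroup_perm hclosed 1 horb, fun k l hkl => ?_, hrange,
    buildingUniversalGroup_mono hXL,
    isCocompactLatticeIn_of_isComplement (isOpen_stabilizer_perm _ 1)
      (isCompact_stabilizer_perm hclosed 1 horb) (existsUnique_mul_mem_stabilizer hreg hXL),
    fun hΓ => ?_⟩
  · simpa using DFunLike.congr_fun hkl 1
  · obtain ⟨s, t, hst, hadj⟩ := SimpleGraph.ne_top_iff_exists_not_adj.1 hΓ
    obtain ⟨f, hf, hfω, hf1⟩ := exists_mem_conjAut_lineGraph_fixing (σ s) (ω s)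
    have : Infinite (X t) :=
      (((hreg t).orbitEquiv (ω t)).trans (σ t)).infinite_iff.2 inferInstance
    exact not_discreteTopology_buildingUniversalGroup hXL hst hadj (hreg s) (hσ s ▸ hf) hfω hf1
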